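/- **Setting.** Fix sets of concept names $A$, role names $r$ and individual names $a$. Roles are $R ::= r \mid \bullet R$, concepts are $D ::= A \mid \top \mid \bot \mid \neg D \mid D\sqcap D \mid D\sqcup D \mid \forall R.D \mid \exists R.D \mid \bullet D$. An $\mathcal{ALCH}^\bullet$ knowledge base $\mathcal K$ consists of finitely many inclusions $D\sqsubseteq E$, role inclusions $R\sqsubseteq S$, and assertions $a:D$, $(a,b):R$, $(a,b):\neg R$. A *bi-ordered interpretation* $\mathcal O$ is a nonempty domain $\Delta$ with the usual interpretation of names and well-founded strict partial orders $<$ on $\Delta$ and $\ll$ on $\Delta\times\Delta$. The classical constructors are interpreted as usual, $(\bullet D)^{\mathcal O}=\min_{<} D^{\mathcal O}$ and $(\bullet R)^{\mathcal O}=\min_{\ll} R^{\mathcal O}$. $\mathcal K$ is *inconsistent* if no bi-ordered interpretation satisfies all its statements. **The matrix $\delta(\mathcal K)$.** Literals are possibly negated atoms $A(t)$, $r(t,u)$, $t<u$, $(t,u)\ll(v,k)$ over terms. A clause is a set of literals (a conjunction), a matrix a set of clauses (a disjunction). Put $M_1\uplus M_2=\{C_1\cup C_2 : C_i\in M_i\}$.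 Let $S$ be a string of variables and let $c_S$ be $f(S)$ with a fresh symbol $f$ (a fresh constant if $S$ is empty). All $x,y,f,g$ below are new at every application of a rule; a role $\bullet\cdots\bullet r$ with at least one $\bullet$ is read as $\bullet r$. For roles: - $\varrho(r,t,u)=\{\{r(t,u)\}\}$ and $\varrho(\neg r,t,u)=\{\{\neg r(t,u)\}\}$; - $\varrho(\neg\bullet r,t,u)=\{\{\neg r(t,u)\}\}\cup\{\{(x,y)\ll(t,u),\,r(x,y)\}\}$; - $\varrho(\bullet r,t,u)=\{\{r(t,u)\}\}\uplus\big[\{\{\neg((f(t),g(u))\ll(t,u))\}\}\cup\varrho(\neg\bullet r,f(t),g(u))\big]$; - $\varrho(\neg\neg R,t,u)=\varrho(R,t,u)$. For concepts: - $\varrho(A,t,S)=\{\{A(t)\}\}$, $\varrho(\neg A,t,S)=\{\{\neg A(t)\}\}$, $\varrho(\top,t,S)=\varrho(\neg\bot,t,S)=\{\emptyset\}$, $\varrho(\bot,t,S)=\varrho(\neg\top,t,S)=\emptyset$, $\varrho(\neg\neg D,t,S)=\varrho(D,t,S)$; - $\varrho(D\sqcap E,t,S)=\varrho(D,t,S)\uplus\varrho(E,t,S)$,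 $\varrho(D\sqcup E,t,S)=\varrho(D,t,S)\cup\varrho(E,t,S)$, and dually $\varrho(\neg(D\sqcap E),t,S)=\varrho(\neg D,t,S)\cup\varrho(\neg E,t,S)$, $\varrho(\neg(D\sqcup E),t,S)=\varrho(\neg D,t,S)\uplus\varrho(\neg E,t,S)$; - $\varrho(\exists R.D,t,S)=\varrho(R,t,x)\uplus\varrho(D,x,S\cdot x)$, $\varrho(\neg\exists R.D,t,S)=\varrho(\neg R,t,c_S)\cup\varrho(\neg D,c_S,S)$; - $\varrho(\forall R.D,t,S)=\varrho(\neg R,t,c_S)\cup\varrho(D,c_S,S)$, $\varrho(\neg\forall R.D,t,S)=\varrho(R,t,x)\uplus\varrho(\neg D,x,S\cdot x)$; - $\varrho(\neg\bullet D,t,S)=\varrho(\neg D,t,S)\cup\big[\{\{x<t\}\}\uplus\varrho(D,x,S\cdot x)\big]$; - $\varrho(\bullet D,t,S)=\varrho(D,t,S)\uplus\big[\{\{\neg(c_S<t)\}\}\cup\varrho(\neg\bullet D,c_S,S)\big]$. Then $\delta(\mathcal K)$ is the union of $\varrho(D\sqcap\neg E,x,x)$ for $D\sqsubseteq E\in\mathcal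 K$, of $\varrho(R,x,y)\uplus\varrho(\neg S,x,y)$ for $R\sqsubseteq S\in\mathcal K$, of $\varrho(\neg D,a,\varepsilon)$ for $a:D\in\mathcal K$, of $\varrho(\neg R,a,b)$ for each assertion $(a,b):R$ in $\mathcal K$ (where $R$ may be negated), and of the clauses $$\{x<y,\,y<z,\,\neg(x<z)\},\quad \{x<x\},\quad \{x<y,\,y<x\},$$ $$\{(x,y)\ll(z,k),\,(z,k)\ll(m,n),\,\neg((x,y)\ll(m,n))\},\quad \{(x,y)\ll(x,y)\},\quad \{(x,y)\ll(z,k),\,(z,k)\ll(x,y)\}.$$ **The procedure.** Let $M=\delta(\mathcal K)$. A multiplicity $\mu$ assigns a natural number to each clause $C$; for $1\le i\le\mu(C)$ the $i$-th copy $C^i$ is $C$ with its variables renamed to new variables belonging to $(C,i)$. The multiplicity $\mu$ and an idempotent term substitution $\sigma$ are chosen once for the whole run. Write $\overline L$ for the complement of $L$. *Blocking.* For a set $p$ of literals and a term $t$, let $\tau_p(t)$ be the set of all $A$, respectively $\neg A$, such that $A(\sigma(t))$, respectively $\neg A(\sigma(t))$, is in $\sigma(p)$. The $n$-th copy $t_n$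 of a term $t$ is blocked in $p$ if $n\ge 2$ and either $t_{n-1}$ is blocked in $p$ or $\tau_p(t_n)\subseteq\tau_p(t_{n-1})$. A literal $L$ is blocked w.r.t. $p$ if $\sigma(L)\in\sigma(p)$, or $L$ belongs to an $n$-th copy ($2\le n\le\mu(C)$) of some $C\in M$ and some non-ground argument $t_n$ of $L$ is blocked in $p\cup\{L\}$. A clause is blocked if one of its literals is. $\mathbf{Proof}(G,M,P)$ returns True iff $G=\emptyset$, or one of the following rules is applicable to $(G,M,P)$ and $\mathbf{Proof}$ returns True on all triples derived by it; in both rules $G=C\cup\{L_1\}$ must not be blocked w.r.t. $P$. - *Reduction:* if $\sigma(L_1)=\sigma(\overline{L_2})$ for some $L_2\in P$, derive $(C,M,P)$. - *Extension:* if $C_1$ is a copy of some clause in $M$, not blocked w.r.t. $P$, and $\sigma(L_1)=\sigma(\overline{L_2})$ for some $L_2\in C_1$, derive $(C_1\setminus\{L_2\},M,P\cup\{L_1\})$ and $(C,M,P)$. $\mathbf{Inconsistent}(\mathcal K)$ returns True iff for some $\mu$, some $\sigma$ and some copy $C_1$ of a clause of $\delta(\mathcal K)$, not blocked w.r.t.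 $\emptyset$, $\mathbf{Proof}(C_1,\delta(\mathcal K),\emptyset)$ returns True. **Theorem (Soundness).** For every $\mathcal{ALCH}^\bullet$ knowledge base $\mathcal K$, if $\mathbf{Inconsistent}(\mathcal K)$ returns True, then $\mathcal K$ is inconsistent. -/

import Mathlib

universe u₁ u₂ u₃ w

namespace ALCHB

/-! ### The description logic: roles, concepts, knowledge bases -/

/-- Roles `R ::= r | •R`, with `r` a role name. -/
inductive Role (NR : Type u₂) : Type u₂
  | name (r : NR) : Role NR
  | bul (R : Role NR) : Role NR

/-- Concepts
`D ::= A | ⊤ | ⊥ | ¬D | D ⊓ D | D ⊔ D | ∀R.D | ∃R.D | •D`, with `A` a concept name. -/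
inductive Concept (NC : Type u₁) (NR : Type u₂) : Type (max u₁ u₂)
  | name (A : NC) : Concept NC NR
  | top : Concept NC NR
  | bot : Concept NC NR
  | neg (D : Concept NC NR) : Concept NC NR
  | and (D E : Concept NC NR) : Concept NC NR
  | or (D E : Concept NC NR) : Concept NC NR
  | all (R : Role NR) (D : Concept NC NR) : Concept NC NR
  | ex (R : Role NR) (D : Concept NC NR) : Concept NC NR
  | bul (D : Concept NC NR) : Concept NC NR

/-- Assertions `a : D`, `(a, b) : R` and `(a, b) : ¬R`. -/
inductive Assertion (NC : Type u₁) (NR : Type u₂) (NI : Type u₃) : Type (max u₁ u₂ u₃)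
  | conc (a : NI) (D : Concept NC NR) : Assertion NC NR NI
  | role (a b : NI) (R : Role NR) : Assertion NC NR NI
  | negRole (a b : NI) (R : Role NR) : Assertion NC NR NI

/-- A knowledge base: finitely many inclusions `D ⊑ E` (pairs `(D, E)`), role inclusions
`R ⊑ S` (pairs `(R, S)`) and assertions. -/
structure KB (NC : Type u₁) (NR : Type u₂) (NI : Type u₃) : Type (max u₁ u₂ u₃) where
  tbox : Finset (Concept NC NR × Concept NC NR)
  rbox : Finset (Role NR × Role NR)
  abox : Finset (Assertion NC NR NI)

/-! ### Bi-ordered interpretations -/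

/-- The minimal elements of `X` with respect to `lt`. -/
def minSet {α : Type w} (lt : α → α → Prop) (X : Set α) : Set α :=
  {x | x ∈ X ∧ ∀ y ∈ X, ¬ lt y x}

/-- Bi-ordered interpretations: a nonempty domain, interpretations of the names, and
well-founded strict partial orders on the domain and on the pairs over the domain. -/
structure Interp (NC : Type u₁) (NR : Type u₂) (NI : Type u₃) : Type (max u₁ u₂ u₃ (w + 1)) where
  Dom : Type w
  nonempty : Nonempty Dom
  ind : NI → Dom
  conc : NC → Set Dom
  role : NR → Set (Dom × Dom)
  lt : Dom → Dom → Prop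
  lt_irrefl : ∀ x, ¬ lt x x
  lt_trans : ∀ x y z, lt x y → lt y z → lt x z
  lt_wf : WellFounded lt
  ll : Dom × Dom → Dom × Dom → Prop
  ll_irrefl : ∀ x, ¬ ll x x
  ll_trans : ∀ x y z, ll x y → ll y z → ll x z
  ll_wf : WellFounded ll

section Semantics

variable {NC : Type u₁} {NR : Type u₂} {NI : Type u₃}

/-- The extension of a role. -/
def Interp.roleExt (O : Interp.{u₁, u₂, u₃, w} NC NR NI) : Role NR → Set (O.Dom × O.Dom)
  | .name r => O.role r
  | .bul R => minSet O.ll (O.roleExt R)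

/-- The extension of a concept. -/
def Interp.ext (O : Interp.{u₁, u₂, u₃, w} NC NR NI) : Concept NC NR → Set O.Dom
  | .name A => O.conc A
  | .top => Set.univ
  | .bot => ∅
  | .neg D => (O.ext D)ᶜ
  | .and D E => O.ext D ∩ O.ext E
  | .or D E => O.ext D ∪ O.ext E
  | .all R D => {x | ∀ y, (x, y) ∈ O.roleExt R → y ∈ O.ext D}
  | .ex R D => {x | ∃ y, (x, y) ∈ O.roleExt R ∧ y ∈ O.ext D}
  | .bul D => minSet O.lt (O.ext D)

/-- Satisfaction of an assertion. -/
def Interp.SatAssertion (O : Interp.{u₁, u₂, u₃, w} NC NR NI) : Assertion NC NR NI → Prop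
  | .conc a D => O.ind a ∈ O.ext D
  | .role a b R => (O.ind a, O.ind b) ∈ O.roleExt R
  | .negRole a b R => (O.ind a, O.ind b) ∉ O.roleExt R

/-- `O` is a model of the knowledge base `K`. -/
def Interp.Sat (O : Interp.{u₁, u₂, u₃, w} NC NR NI) (K : KB NC NR NI) : Prop :=
  (∀ c ∈ K.tbox, O.ext c.1 ⊆ O.ext c.2) ∧
  (∀ c ∈ K.rbox, O.roleExt c.1 ⊆ O.roleExt c.2) ∧
  (∀ α ∈ K.abox, O.SatAssertion α)

/-- `K` is inconsistent: no bi-ordered interpretation is a model of `K`. -/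
def KB.Inconsistent (K : KB NC NR NI) : Prop :=
  ∀ O : Interp.{u₁, u₂, u₃, w} NC NR NI, ¬ O.Sat K

end Semantics

/-! ### Terms, literals, matrices -/

/-- Terms over variables `V`, individual names `NI` and function symbols `F`.  A symbol applied
to `0` arguments is a constant. -/
inductive Term (F : Type u₁) (NI : Type u₂) (V : Type u₃) : Type (max u₁ u₂ u₃)
  | var (x : V) : Term F NI V
  | ind (a : NI) : Term F NI V
  | app (f : F) (n : ℕ) (ts : Fin n → Term F NI V) : Term F NI V

/-- Simultaneous substitution of terms for variables. -/
def Term.subst {F : Type u₁} {NI : Type u₂} {V : Type u₃} {W : Type w} (s : V → Term F NI W) :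
    Term F NI V → Term F NI W
  | .var x => s x
  | .ind a => .ind a
  | .app f n ts => .app f n (fun i => (ts i).subst s)

/-- The variables of a term. -/
def Term.vars {F : Type u₁} {NI : Type u₂} {V : Type u₃} : Term F NI V → Set V
  | .var x => {x}
  | .ind _ => ∅
  | .app _ _ ts => ⋃ i, (ts i).vars

/-- Atoms `A(t)`, `r(t, u)`, `t < u` and `(t, u) ≪ (v, k)` over a type `T` of terms. -/
inductive Atom (NC : Type u₁) (NR : Type u₂) (T : Type u₃) : Type (max u₁ u₂ u₃)
  | conc (A : NC) (t : T) : Atom NC NR T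
  | role (r : NR) (t u : T) : Atom NC NR T
  | lt (t u : T) : Atom NC NR T
  | ll (t u v k : T) : Atom NC NR T

/-- The atom with every argument replaced by its image. -/
def Atom.map {NC : Type u₁} {NR : Type u₂} {T : Type u₃} {T' : Type w} (g : T → T') :
    Atom NC NR T → Atom NC NR T'
  | .conc A t => .conc A (g t)
  | .role r t u => .role r (g t) (g u)
  | .lt t u => .lt (g t) (g u)
  | .ll t u v k => .ll (g t) (g u) (g v) (g k)

/-- The arguments of an atom. -/
def Atom.args {NC : Type u₁} {NR : Type u₂} {T : Type u₃} : Atom NC NR T → List T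
  | .conc _ t => [t]
  | .role _ t u => [t, u]
  | .lt t u => [t, u]
  | .ll t u v k => [t, u, v, k]

/-- A literal: an atom (`sign = true`) or a negated atom (`sign = false`). -/
structure Literal (NC : Type u₁) (NR : Type u₂) (T : Type u₃) : Type (max u₁ u₂ u₃) where
  sign : Bool
  atom : Atom NC NR T

/-- The complement of a literal. -/
def Literal.compl {NC : Type u₁} {NR : Type u₂} {T : Type u₃} (L : Literal NC NR T) :
    Literal NC NR T :=
  ⟨!L.sign, L.atom⟩

/-- The literal with every argument replaced by its image. -/
def Literal.map {NC : Type u₁} {NR : Type u₂} {T : Type u₃} {T' : Type w} (g : T → T')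
    (L : Literal NC NR T) : Literal NC NR T' :=
  ⟨L.sign, L.atom.map g⟩

/-- The statements of a knowledge base; they label the Herbrand symbols, so that different
statements get different symbols. -/
inductive Stmt (NC : Type u₁) (NR : Type u₂) (NI : Type u₃) : Type (max u₁ u₂ u₃)
  | gci (D E : Concept NC NR) : Stmt NC NR NI
  | rincl (R S : Role NR) : Stmt NC NR NI
  | assertion (α : Assertion NC NR NI) : Stmt NC NR NI

/-- Herbrand symbols.  A symbol is labelled by a statement and by the position (a list of numbers)
in the recursive translation of that statement at which it is introduced: `conc` is the symbol `f`
of the translation of concepts, `fst` and `snd` are the symbols `f` and `g` of the translation of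
roles. -/
inductive HSym (NC : Type u₁) (NR : Type u₂) (NI : Type u₃) : Type (max u₁ u₂ u₃)
  | conc (o : Stmt NC NR NI) (p : List ℕ) : HSym NC NR NI
  | fst (o : Stmt NC NR NI) (p : List ℕ) : HSym NC NR NI
  | snd (o : Stmt NC NR NI) (p : List ℕ) : HSym NC NR NI

/-- Variables of matrices: a number and the position at which the variable is introduced. -/
abbrev Var : Type := ℕ × List ℕ

/-- Terms over the variables `V`. -/
abbrev Tm (NC : Type u₁) (NR : Type u₂) (NI : Type u₃) (V : Type w) : Type (max u₁ u₂ u₃ w) :=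
  Term (HSym NC NR NI) NI V

/-- Literals over the variables `V`. -/
abbrev Lit (NC : Type u₁) (NR : Type u₂) (NI : Type u₃) (V : Type w) : Type (max u₁ u₂ u₃ w) :=
  Literal NC NR (Tm NC NR NI V)

/-- Clauses: sets of literals, read as conjunctions. -/
abbrev Clause (NC : Type u₁) (NR : Type u₂) (NI : Type u₃) : Type (max u₁ u₂ u₃) :=
  Set (Lit NC NR NI Var)

/-- Matrices: sets of clauses, read as disjunctions. -/
abbrev Mat (NC : Type u₁) (NR : Type u₂) (NI : Type u₃) : Type (max u₁ u₂ u₃) :=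
  Set (Clause NC NR NI)

section Translation

variable {NC : Type u₁} {NR : Type u₂} {NI : Type u₃}

/-- The matrix `{{L}}` of the literal with the given sign and atom. -/
def unit (b : Bool) (a : Atom NC NR (Tm NC NR NI Var)) : Mat NC NR NI := {{⟨b, a⟩}}

/-- Clausal union: all unions of a clause of `M₁` and a clause of `M₂`. -/
def clup (M₁ M₂ : Mat NC NR NI) : Mat NC NR NI := {C | ∃ C₁ ∈ M₁, ∃ C₂ ∈ M₂, C = C₁ ∪ C₂}

/-- Application of the Herbrand symbol `f` to a string of terms; it is a constant if the string is
empty. -/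
def apply (f : HSym NC NR NI) (S : List (Tm NC NR NI Var)) : Tm NC NR NI Var :=
  .app f S.length (fun i => S.get i)

/-- The role name of a role. -/
def Role.base : Role NR → NR
  | .name r => r
  | .bul R => R.base

/-- Whether a role starts with `•`.  As `•` is idempotent, a role is translated as `•r` if this
holds and as `r` otherwise, where `r` is its role name. -/
def Role.isBul : Role NR → Bool
  | .name _ => false
  | .bul _ => true

/-- The translation of `¬•r`, with the variables introduced at position `p`. -/
def rhoNegBulRole (p : List ℕ) (r : NR) (t u : Tm NC NR NI Var) : Mat NC NR NI :=
  unit false (.role r t u) ∪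
    clup (unit true (.ll (.var (0, p)) (.var (1, p)) t u))
      (unit true (.role r (.var (0, p)) (.var (1, p))))

/-- The translation of `•r`, with the symbols and variables introduced at position `p`. -/
def rhoBulRole (o : Stmt NC NR NI) (p : List ℕ) (r : NR) (t u : Tm NC NR NI Var) : Mat NC NR NI :=
  clup (unit true (.role r t u))
    (unit false (.ll (apply (.fst o p) [t]) (apply (.snd o p) [u]) t u) ∪
      rhoNegBulRole p r (apply (.fst o p) [t]) (apply (.snd o p) [u]))

/-- The translation of the role `R` (for `b = true`) or of `¬R` (for `b = false`). -/
def rhoRole (o : Stmt NC NR NI) (b : Bool) (R : Role NR) (p : List ℕ) (t u : Tm NC NR NI Var) :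
    Mat NC NR NI :=
  match R.isBul, b with
  | false, b => unit b (.role R.base t u)
  | true, true => rhoBulRole o p R.base t u
  | true, false => rhoNegBulRole p R.base t u

/-- The translation of the concept `D` (for `b = true`) or of `¬D` (for `b = false`) at the term `t`
in the scope of the string `S`, with the symbols and variables introduced at positions extending
`p`. -/
def rho (o : Stmt NC NR NI) : Concept NC NR → Bool → List ℕ → Tm NC NR NI Var →
    List (Tm NC NR NI Var) → Mat NC NR NI
  | .name A, b, _, t, _ => unit b (.conc A t)
  | .top, true, _, _, _ => {∅}
  | .top, false, _, _, _ => ∅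
  | .bot, true, _, _, _ => ∅
  | .bot, false, _, _, _ => {∅}
  | .neg D, b, p, t, S => rho o D (!b) (0 :: p) t S
  | .and D E, true, p, t, S => clup (rho o D true (0 :: p) t S) (rho o E true (1 :: p) t S)
  | .and D E, false, p, t, S => rho o D false (0 :: p) t S ∪ rho o E false (1 :: p) t S
  | .or D E, true, p, t, S => rho o D true (0 :: p) t S ∪ rho o E true (1 :: p) t S
  | .or D E, false, p, t, S => clup (rho o D false (0 :: p) t S) (rho o E false (1 :: p) t S)
  | .ex R D, true, p, t, S =>
      clup (rhoRole o true R (0 :: p) t (.var (0, p)))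
        (rho o D true (1 :: p) (.var (0, p)) (S ++ [.var (0, p)]))
  | .ex R D, false, p, t, S =>
      rhoRole o false R (0 :: p) t (apply (.conc o p) S) ∪
        rho o D false (1 :: p) (apply (.conc o p) S) S
  | .all R D, true, p, t, S =>
      rhoRole o false R (0 :: p) t (apply (.conc o p) S) ∪
        rho o D true (1 :: p) (apply (.conc o p) S) S
  | .all R D, false, p, t, S =>
      clup (rhoRole o true R (0 :: p) t (.var (0, p)))
        (rho o D false (1 :: p) (.var (0, p)) (S ++ [.var (0, p)]))
  | .bul D, true, p, t, S =>
      -- the last two lines are the translation of `¬•D` at the Herbrand term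
      clup (rho o D true (0 :: p) t S)
        (unit false (.lt (apply (.conc o p) S) t) ∪
          (rho o D false (1 :: p) (apply (.conc o p) S) S ∪
            clup (unit true (.lt (.var (0, p)) (apply (.conc o p) S)))
              (rho o D true (2 :: p) (.var (0, p)) (S ++ [.var (0, p)]))))
  | .bul D, false, p, t, S =>
      rho o D false (1 :: p) t S ∪
        clup (unit true (.lt (.var (0, p)) t))
          (rho o D true (2 :: p) (.var (0, p)) (S ++ [.var (0, p)]))

/-- The variables `x, y, z, k, m, n, …` at the root position. -/
def rootVar (i : ℕ) : Tm NC NR NI Var := .var (i, [])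

/-- The matrix of an assertion (translated negated). -/
def deltaAssertion (α : Assertion NC NR NI) : Mat NC NR NI :=
  match α with
  | .conc a D => rho (.assertion α) D false [0] (.ind a) []
  | .role a b R => rhoRole (.assertion α) false R [0] (.ind a) (.ind b)
  | .negRole a b R => rhoRole (.assertion α) true R [0] (.ind a) (.ind b)

/-- The matrix of `D ⊑ E`, that is, of `D ⊓ ¬E` at a variable. -/
def deltaGCI (D E : Concept NC NR) : Mat NC NR NI :=
  clup (rho (.gci D E) D true [0] (rootVar 0) [rootVar 0])
    (rho (.gci D E) E false [1] (rootVar 0) [rootVar 0])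

/-- The matrix of `R ⊑ S`. -/
def deltaRIncl (R S : Role NR) : Mat NC NR NI :=
  clup (rhoRole (.rincl R S) true R [0] (rootVar 0) (rootVar 1))
    (rhoRole (.rincl R S) false S [1] (rootVar 0) (rootVar 1))

/-- The clauses that express (negated) that `<` and `≪` are strict partial orders. -/
def orderMat : Mat NC NR NI :=
  let x : Tm NC NR NI Var := rootVar 0
  let y : Tm NC NR NI Var := rootVar 1
  let z : Tm NC NR NI Var := rootVar 2
  let k : Tm NC NR NI Var := rootVar 3
  let m : Tm NC NR NI Var := rootVar 4
  let n : Tm NC NR NI Var := rootVar 5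
  { {⟨true, .lt x y⟩, ⟨true, .lt y z⟩, ⟨false, .lt x z⟩},
    {⟨true, .lt x x⟩},
    {⟨true, .lt x y⟩, ⟨true, .lt y x⟩},
    {⟨true, .ll x y z k⟩, ⟨true, .ll z k m n⟩, ⟨false, .ll x y m n⟩},
    {⟨true, .ll x y x y⟩},
    {⟨true, .ll x y z k⟩, ⟨true, .ll z k x y⟩} }

/-- The matrix `δ(K)` of a knowledge base. -/
def delta (K : KB NC NR NI) : Mat NC NR NI :=
  (⋃ c ∈ K.tbox, deltaGCI c.1 c.2) ∪ (⋃ c ∈ K.rbox, deltaRIncl c.1 c.2) ∪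
    (⋃ α ∈ K.abox, deltaAssertion α) ∪ orderMat

end Translation

/-! ### The connection calculus and the procedures -/

/-- Variables of copies: `(C, i, x)` is the variable `x` in the `i`-th copy of the clause `C`. -/
abbrev CopyVar (NC : Type u₁) (NR : Type u₂) (NI : Type u₃) : Type (max u₁ u₂ u₃) :=
  Clause NC NR NI × ℕ × Var

/-- Literals over the variables of copies. -/
abbrev CLit (NC : Type u₁) (NR : Type u₂) (NI : Type u₃) : Type (max u₁ u₂ u₃) :=
  Lit NC NR NI (CopyVar NC NR NI)

/-- Term substitutions. -/
abbrev Subst (NC : Type u₁) (NR : Type u₂) (NI : Type u₃) : Type (max u₁ u₂ u₃) :=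
  CopyVar NC NR NI → Tm NC NR NI (CopyVar NC NR NI)

section Calculus

variable {NC : Type u₁} {NR : Type u₂} {NI : Type u₃}

/-- Idempotent substitutions. -/
def Subst.Idempotent (σ : Subst NC NR NI) : Prop := ∀ x, (σ x).subst σ = σ x

/-- The literal `σ(L)`. -/
def inst (σ : Subst NC NR NI) (L : CLit NC NR NI) : CLit NC NR NI := L.map (Term.subst σ)

/-- A term of the clause `C`, in the `i`-th copy of `C`. -/
def copyTerm (C : Clause NC NR NI) (i : ℕ) (t : Tm NC NR NI Var) :
    Tm NC NR NI (CopyVar NC NR NI) :=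
  t.subst (fun x => .var (C, i, x))

/-- The `i`-th copy of the clause `C`. -/
def copyClause (C : Clause NC NR NI) (i : ℕ) : Set (CLit NC NR NI) :=
  (fun L => L.map (copyTerm C i)) '' C

/-- The set of concepts of the term `t`: the concept names `A` (as `(true, A)`) and negated concept
names `¬A` (as `(false, A)`) that hold of `σ(t)` on `σ(p)`. -/
def conceptsOf (σ : Subst NC NR NI) (p : Set (CLit NC NR NI))
    (t : Tm NC NR NI (CopyVar NC NR NI)) : Set (Bool × NC) :=
  {D | (⟨D.1, .conc D.2 (t.subst σ)⟩ : CLit NC NR NI) ∈ inst σ '' p}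

/-- The `n`-th copy of the term `t` of the clause `C` is blocked: `n ≥ 2`, and the previous copy is
blocked or has all the concepts of the `n`-th copy. -/
def TermBlocked (σ : Subst NC NR NI) (p : Set (CLit NC NR NI)) (C : Clause NC NR NI)
    (t : Tm NC NR NI Var) : ℕ → Prop
  | 0 => False
  | 1 => False
  | n + 2 => TermBlocked σ p C t (n + 1) ∨
      conceptsOf σ p (copyTerm C (n + 2) t) ⊆ conceptsOf σ p (copyTerm C (n + 1) t)

/-- The literal `L` is blocked with respect to the path `p`: `σ(L)` is on `σ(p)`, or `L` belongs to
an `n`-th copy with `n ≥ 2`, and a term of `L` (one that changes with the copy, that is, has a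
variable) is blocked with respect to the path `p ∪ {L}`. -/
def LitBlocked (M : Mat NC NR NI) (μ : Clause NC NR NI → ℕ) (σ : Subst NC NR NI)
    (p : Set (CLit NC NR NI)) (L : CLit NC NR NI) : Prop :=
  inst σ L ∈ inst σ '' p ∨
  ∃ C ∈ M, ∃ n, 2 ≤ n ∧ n ≤ μ C ∧ ∃ L₀ ∈ C, L = L₀.map (copyTerm C n) ∧
    ∃ t ∈ L₀.atom.args, t.vars.Nonempty ∧ TermBlocked σ (insert L p) C t n

/-- A clause is blocked if one of its literals is. -/
def ClauseBlocked (M : Mat NC NR NI) (μ : Clause NC NR NI → ℕ) (σ : Subst NC NR NI)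
    (p : Set (CLit NC NR NI)) (G : Set (CLit NC NR NI)) : Prop :=
  ∃ L ∈ G, LitBlocked M μ σ p L

/-- `RuleApp M μ σ G P ts`: a rule applies to the goal `G` with active path `P`, and `ts` lists the
goals and paths derived by it. -/
inductive RuleApp (M : Mat NC NR NI) (μ : Clause NC NR NI → ℕ) (σ : Subst NC NR NI) :
    Set (CLit NC NR NI) → Set (CLit NC NR NI) →
      List (Set (CLit NC NR NI) × Set (CLit NC NR NI)) → Prop
  | reduction (C P : Set (CLit NC NR NI)) (L₁ L₂ : CLit NC NR NI) :
      ¬ ClauseBlocked M μ σ P (insert L₁ C) →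
      L₂ ∈ P →
      inst σ L₁ = inst σ L₂.compl →
      RuleApp M μ σ (insert L₁ C) P [(C, P)]
  | extension (C P : Set (CLit NC NR NI)) (L₁ L₂ : CLit NC NR NI)
      (C₂ : Clause NC NR NI) (i : ℕ) :
      ¬ ClauseBlocked M μ σ P (insert L₁ C) →
      C₂ ∈ M → 1 ≤ i → i ≤ μ C₂ →
      ¬ ClauseBlocked M μ σ P (copyClause C₂ i) →
      L₂ ∈ copyClause C₂ i →
      inst σ L₁ = inst σ L₂.compl →
      RuleApp M μ σ (insert L₁ C) P [(copyClause C₂ i \ {L₂}, insert L₁ P), (C, P)]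

/-- The procedure `Proof` returns `True` on the goal `G`, the matrix `M` and the path `P`, for the
multiplicity `μ` and the substitution `σ` of the whole proof: the goal is empty, or some rule
applies such that `Proof` returns `True` on everything derived by it. -/
inductive ProofTrue (M : Mat NC NR NI) (μ : Clause NC NR NI → ℕ) (σ : Subst NC NR NI) :
    Set (CLit NC NR NI) → Set (CLit NC NR NI) → Prop
  | empty (P : Set (CLit NC NR NI)) : ProofTrue M μ σ ∅ P
  | rule (G P : Set (CLit NC NR NI)) (ts : List (Set (CLit NC NR NI) × Set (CLit NC NR NI))) :
      RuleApp M μ σ G P ts → (∀ T ∈ ts, ProofTrue M μ σ T.1 T.2) → ProofTrue M μ σ G P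

/-- The procedure `Inconsistent` returns `True` on `K`: for some multiplicity, some substitution and
some (copy of a) clause of `δ(K)`, the procedure `Proof` returns `True` with the empty path. -/
def InconsistentReturnsTrue (K : KB NC NR NI) : Prop :=
  ∃ (μ : Clause NC NR NI → ℕ) (σ : Subst NC NR NI), σ.Idempotent ∧
    ∃ C ∈ delta K, ∃ i, 1 ≤ i ∧ i ≤ μ C ∧ ¬ ClauseBlocked (delta K) μ σ ∅ (copyClause C i) ∧
      ProofTrue (delta K) μ σ (copyClause C i) ∅

end Calculus

end ALCHB

namespace ALCHB

variable {NC : Type u₁} {NR : Type u₂} {NI : Type u₃}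

/-! ### Minimal elements and role extensions -/

/-! The matrix of K is a disjunction of conjunctive clauses expressing that K fails. Over a model
`O` of K the Herbrand symbols can be interpreted so that every clause has a false literal under
every valuation (`exists_matFalse_delta`). On the other hand, in a successful connection proof,
false path literals force all goal literals to be true (`ProofTrue.sound`); for the start clause,
whose path is empty, the two facts collide. Blocking only forbids rule applications, so it cannot
harm soundness.

The difficulty lies in the symbols f, g of •r. If r(t,u) holds but (t,u) is not minimal, then (f(t),
g(u)) must be a minimal pair below (t,u), although f sees only t and g only u; in `O` itself such
functions need not exist. The domain is therefore expanded by free copies `fst r t` and `snd r u`,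
and this pair is placed below (t,u) by decree. It receives the roles common to all minimal pairs of
r: which of these lies below a given pair varies, and taking all of them keeps the order compatible
with every other •s (`exists_protos_ll`). Concepts and < are pulled back along `proj`, which is a
bounded morphism for roles (`proj_mem_roleExt`, `mem_skRole_base`), so concepts can be evaluated at
projections. The matrix asks the expanded orders only to be strict partial orders; well-foundedness
is used in `O`, to find minimal elements.

The remaining symbols are chosen by recursion on concepts (`forceable_rho`). The choices are
independent because every symbol carries its statement and position. -/

theorem minSet_minSet {α : Type w} (lt : α → α → Prop) (X : Set α) :
    minSet lt (minSet lt X) = minSet lt X := by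
  ext x
  exact ⟨fun h => h.1, fun h => ⟨h, fun y hy => h.2 y hy.1⟩⟩

theorem exists_minSet_eq_or_lt {α : Type w} {lt : α → α → Prop} (wf : WellFounded lt)
    (tr : ∀ x y z, lt x y → lt y z → lt x z) {X : Set α} {x : α} (hx : x ∈ X) :
    ∃ y ∈ minSet lt X, y = x ∨ lt y x := by
  induction x using wf.induction with
  | _ x ih =>
    by_cases h : ∃ y ∈ X, lt y x
    · obtain ⟨y, hy, hyx⟩ := h
      obtain ⟨z, hz, rfl | hzy⟩ := ih y hyx hy
      · exact ⟨z, hz, .inr hyx⟩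
      · exact ⟨z, hz, .inr (tr _ _ _ hzy hyx)⟩
    · push Not at h
      exact ⟨x, ⟨hx, h⟩, .inl rfl⟩

theorem exists_minSet_lt {α : Type w} {lt : α → α → Prop} (wf : WellFounded lt)
    (tr : ∀ x y z, lt x y → lt y z → lt x z) {X : Set α} {x : α} (hx : x ∈ X)
    (hm : x ∉ minSet lt X) : ∃ y ∈ minSet lt X, lt y x := by
  obtain ⟨y, hy, rfl | h⟩ := exists_minSet_eq_or_lt wf tr hx
  · exact absurd hy hm
  · exact ⟨y, hy, h⟩

/-- Iterated bullets collapse because taking minimal elements is idempotent; this justifies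
translating every bulleted role as a single •r. -/
theorem Interp.roleExt_eq (O : Interp.{u₁, u₂, u₃, w} NC NR NI) (R : Role NR) :
    O.roleExt R = if R.isBul then minSet O.ll (O.role R.base) else O.role R.base := by
  induction R with
  | name r => simp [Interp.roleExt, Role.isBul, Role.base]
  | bul R ih =>
    rw [Interp.roleExt, ih]
    change _ = minSet O.ll (O.role R.base)
    split
    · exact minSet_minSet _ _
    · rfl

/-! ### The expanded domain

The Herbrand symbols `f` and `g` of `•r` depend on one component of a pair each.  Interpreting them
requires a domain with enough copies of the components of minimal pairs. -/

/-- The domain `Δ` expanded freely by unary functions `fst r` and `snd r` for every role name. -/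
inductive SkDom (Δ : Type w) (NR : Type u₂) : Type (max u₂ w)
  | base (d : Δ) : SkDom Δ NR
  | fst (r : NR) (t : SkDom Δ NR) : SkDom Δ NR
  | snd (r : NR) (t : SkDom Δ NR) : SkDom Δ NR

section Expansion

variable (O : Interp.{u₁, u₂, u₃, w} NC NR NI)

/-- A minimal pair of the role name `r`, if there is one. -/
noncomputable def minPair (r : NR) : O.Dom × O.Dom :=
  haveI := O.nonempty
  Classical.epsilon fun q => q ∈ minSet O.ll (O.role r)

/-- The element of the original domain of which an element of the expanded domain is a copy. -/
noncomputable def proj : SkDom O.Dom NR → O.Dom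
  | .base d => d
  | .fst r _ => (minPair O r).1
  | .snd r _ => (minPair O r).2

/-- The pairs of the original domain whose common roles are the roles of `(t, u)`, provided that
`(t, u)` is active. -/
def protos (t : SkDom O.Dom NR) : SkDom O.Dom NR → Set (O.Dom × O.Dom)
  | .base y => {(proj O t, y)}
  | .fst _ _ => ∅
  -- All minimal pairs, not just `minPair`: the pair found below a prototype `Q` of the older pair
  -- depends on `Q`.
  | .snd s _ => minSet O.ll (O.role s)

/-- The pairs of the expanded domain that may belong to roles. -/
def Active : SkDom O.Dom NR → SkDom O.Dom NR → Prop
  | _, .base _ => True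
  -- Precisely the situation in which the symbols of •r are needed: (t,u) belongs to r but not to
  -- •r.
  | .fst r t, .snd s u => r = s ∧ Active t u ∧ protos O t u ⊆ O.role r ∧
      ¬ protos O t u ⊆ minSet O.ll (O.role r)
  | _, _ => False

/-- The extension of a role in the expanded domain. -/
def skRole (R : Role NR) : Set (SkDom O.Dom NR × SkDom O.Dom NR) :=
  {p | Active O p.1 p.2 ∧ protos O p.1 p.2 ⊆ O.roleExt R}

/-- `SkStep p q`: the pair `p` is the result of `fst r` and `snd r` at the pair `q`. -/
def SkStep {Δ : Type w} (p q : SkDom Δ NR × SkDom Δ NR) : Prop :=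
  ∃ r, p = (.fst r q.1, .snd r q.2)

/-- The order on the pairs over the expanded domain. -/
def SkLL (p q : SkDom O.Dom NR × SkDom O.Dom NR) : Prop :=
  Relation.TransGen SkStep p q ∨
    -- A pair ending in `base` has a single prototype, so the order of `O` is transferred to such
    -- pairs and to whatever is generated below them.
    ∃ t y v k, Relation.ReflTransGen SkStep p (t, .base y) ∧ q = (v, .base k) ∧
      O.ll (proj O t, y) (proj O v, k)

/-! ### Strict partial order on the expanded pairs -/

theorem not_transGen_skStep_base {Δ : Type w} {t : SkDom Δ NR} {y : Δ}
    {q : SkDom Δ NR × SkDom Δ NR} : ¬ Relation.TransGen SkStep (t, .base y) q := by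
  intro h
  obtain ⟨_, ⟨r, hr⟩, _⟩ := Relation.TransGen.head'_iff.1 h
  simp at hr

/-- Each step adds a constructor to the second component, so the step relation has no cycles. -/
theorem sizeOf_snd_lt_of_transGen {Δ : Type w} {p q : SkDom Δ NR × SkDom Δ NR}
    (h : Relation.TransGen SkStep p q) : sizeOf q.2 < sizeOf p.2 := by
  induction h with
  | single h => obtain ⟨r, rfl⟩ := h; simp
  | tail _ h ih => obtain ⟨r, rfl⟩ := h; simp at ih; omega

theorem eq_of_reflTransGen_skStep_base {Δ : Type w} {t : SkDom Δ NR} {y : Δ}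
    {q : SkDom Δ NR × SkDom Δ NR} (h : Relation.ReflTransGen SkStep (t, .base y) q) :
    q = (t, .base y) := by
  rcases Relation.reflTransGen_iff_eq_or_transGen.1 h with h | h
  · exact h
  · exact absurd h not_transGen_skStep_base

theorem skLL_irrefl (p : SkDom O.Dom NR × SkDom O.Dom NR) : ¬ SkLL O p p := by
  rintro (h | ⟨t, y, v, k, h, rfl, hl⟩)
  · exact lt_irrefl _ (sizeOf_snd_lt_of_transGen h)
  · have := eq_of_reflTransGen_skStep_base h
    simp only [Prod.mk.injEq, SkDom.base.injEq] at this
    obtain ⟨rfl, rfl⟩ := this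
    exact O.ll_irrefl _ hl

theorem skLL_trans {p q r : SkDom O.Dom NR × SkDom O.Dom NR} (hpq : SkLL O p q)
    (hqr : SkLL O q r) : SkLL O p r := by
  rcases hpq with h | ⟨t, y, v, k, h, rfl, hl⟩
  · rcases hqr with h' | ⟨t', y', v', k', h', rfl, hl'⟩
    · exact .inl (h.trans h')
    · exact .inr ⟨t', y', v', k', h.to_reflTransGen.trans h', rfl, hl'⟩
  · rcases hqr with h' | ⟨t', y', v', k', h', rfl, hl'⟩
    · exact absurd h' not_transGen_skStep_base
    · have := eq_of_reflTransGen_skStep_base h'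
      simp only [Prod.mk.injEq, SkDom.base.injEq] at this
      obtain ⟨rfl, rfl⟩ := this
      exact .inr ⟨t, y, v', k', h, rfl, O.ll_trans _ _ _ hl hl'⟩

/-- The order on expanded pairs is reflected by some prototypes. In a single step, activity provides
a prototype `Q` in r that is not minimal, hence a minimal pair strictly below it. Further steps only
descend, since every prototype in r has a minimal pair of r at or below it. -/
theorem exists_protos_ll_of_transGen {p q : SkDom O.Dom NR × SkDom O.Dom NR}
    (h : Relation.TransGen SkStep p q) (hp : Active O p.1 p.2) :
    ∃ Q ∈ protos O q.1 q.2, ∃ Q' ∈ protos O p.1 p.2, O.ll Q' Q := by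
  induction h using Relation.TransGen.head_induction_on with
  | single h =>
    obtain ⟨r, rfl⟩ := h
    obtain ⟨-, -, hr, hm⟩ := hp
    obtain ⟨Q, hQ, hQm⟩ := Set.not_subset.1 hm
    obtain ⟨Q', hQ', hl⟩ := exists_minSet_lt O.ll_wf O.ll_trans (hr hQ) hQm
    exact ⟨Q, hQ, Q', hQ', hl⟩
  | head h _ ih =>
    obtain ⟨r, rfl⟩ := h
    obtain ⟨-, ha, hr, -⟩ := hp
    obtain ⟨Q, hQ, Q₁, hQ₁, hl⟩ := ih ha
    obtain ⟨Q', hQ', rfl | hl'⟩ := exists_minSet_eq_or_lt O.ll_wf O.ll_trans (hr hQ₁)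
    · exact ⟨Q, hQ, Q', hQ', hl⟩
    · exact ⟨Q, hQ, Q', hQ', O.ll_trans _ _ _ hl' hl⟩

theorem exists_protos_ll {p q : SkDom O.Dom NR × SkDom O.Dom NR} (h : SkLL O p q)
    (hp : Active O p.1 p.2) :
    ∃ Q ∈ protos O q.1 q.2, ∃ Q' ∈ protos O p.1 p.2, O.ll Q' Q := by
  rcases h with h | ⟨t, y, v, k, h, rfl, hl⟩
  · exact exists_protos_ll_of_transGen O h hp
  · rcases Relation.reflTransGen_iff_eq_or_transGen.1 h with rfl | h
    · exact ⟨_, rfl, _, rfl, hl⟩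
    · obtain ⟨Q, hQ, Q', hQ', hl'⟩ := exists_protos_ll_of_transGen O h hp
      obtain rfl : Q = _ := hQ
      exact ⟨_, rfl, Q', hQ', O.ll_trans _ _ _ hl' hl⟩

/-- The extension of a role depends only on its role name and on whether it starts with `•`. -/
theorem skRole_eq (R : Role NR) :
    skRole O R = skRole O (if R.isBul then .bul (.name R.base) else .name R.base) := by
  unfold skRole
  rw [O.roleExt_eq R]
  split <;> rfl

theorem skRole_bul_subset (r : NR) : skRole O (.bul (.name r)) ⊆ skRole O (.name r) :=
  fun _ hp => ⟨hp.1, fun _ hQ => (hp.2 hQ).1⟩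

/-- Otherwise some prototype of `p`, which lies in r, would be below a prototype of `q`, which is
minimal in r. -/
theorem not_skLL_of_mem_bul {r : NR} {p q : SkDom O.Dom NR × SkDom O.Dom NR}
    (hq : q ∈ skRole O (.bul (.name r))) (hp : p ∈ skRole O (.name r)) : ¬ SkLL O p q := by
  intro h
  obtain ⟨Q, hQ, Q', hQ', hl⟩ := exists_protos_ll O h hp.1
  exact (hq.2 hQ).2 Q' (hp.2 hQ') hl

/-- The hypotheses are the activity condition of the new pair, and its prototypes are by definition
the minimal pairs of r. -/
theorem mem_skRole_bul_of_not_mem {r : NR} {t u : SkDom O.Dom NR}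
    (h : (t, u) ∈ skRole O (.name r)) (hm : (t, u) ∉ skRole O (.bul (.name r))) :
    (SkDom.fst r t, SkDom.snd r u) ∈ skRole O (.bul (.name r)) :=
  ⟨⟨rfl, h.1, h.2, fun hs => hm ⟨h.1, hs⟩⟩, fun _ hQ => hQ⟩

theorem skLL_fst_snd (r : NR) (t u : SkDom O.Dom NR) :
    SkLL O (SkDom.fst r t, SkDom.snd r u) (t, u) :=
  .inl (.single ⟨r, rfl⟩)

/-- The forth condition of a bounded morphism. For a generated pair, activity shows that r has a
minimal pair, so `minPair` is one and hence a prototype. -/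
theorem proj_mem_roleExt : ∀ {t u : SkDom O.Dom NR} {R : Role NR}, (t, u) ∈ skRole O R →
    (proj O t, proj O u) ∈ O.roleExt R
  | _, .base _, _, h => h.2 rfl
  | .fst r t, .snd s u, R, h => by
    obtain ⟨⟨rfl, -, hr, hm⟩, hR⟩ := h
    obtain ⟨Q, hQ, -⟩ := Set.not_subset.1 hm
    obtain ⟨Q', hQ', -⟩ := exists_minSet_eq_or_lt O.ll_wf O.ll_trans (hr hQ)
    exact hR (Classical.epsilon_spec (p := fun q => q ∈ minSet O.ll (O.role r)) ⟨Q', hQ'⟩)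
  | .base _, .snd _ _, _, h => h.1.elim
  | .snd _ _, .snd _ _, _, h => h.1.elim
  | _, .fst _ _, _, h => by
    have := h.1
    simp [Active] at this

/-- The back condition: successors of `proj O t` in `O` are successors of `t` as base elements. All
witnesses for concepts are therefore chosen in the base. -/
theorem mem_skRole_base {t : SkDom O.Dom NR} {y : O.Dom} {R : Role NR} :
    (t, SkDom.base y) ∈ skRole O R ↔ (proj O t, y) ∈ O.roleExt R := by
  simp [skRole, Active, protos]

end Expansion

/-! ### Terms, literals and matrices in the expanded domain -/

/-- The value of a term. -/
def Term.eval {F : Type u₁} {V : Type u₂} {D : Type w} (H : F → List D → D) (c : NI → D)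
    (e : V → D) : Term F NI V → D
  | .var x => e x
  | .ind a => c a
  | .app f _ ts => H f (List.ofFn fun i => (ts i).eval H c e)

theorem Term.eval_subst {F : Type u₁} {V : Type u₂} {W : Type*} {D : Type w} (H : F → List D → D)
    (c : NI → D) (e : W → D) (s : V → Term F NI W) (t : Term F NI V) :
    (t.subst s).eval H c e = t.eval H c (fun x => (s x).eval H c e) := by
  induction t with
  | var x => rfl
  | ind a => rfl
  | app f n ts ih => simp only [Term.subst, Term.eval, ih]

theorem Literal.map_map {T : Type*} {T' : Type*} {T'' : Type*} (g : T → T') (h : T' → T'')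
    (L : Literal NC NR T) : (L.map g).map h = L.map (h ∘ g) := by
  obtain ⟨b, a⟩ := L
  cases a <;> rfl

section Truth

variable (O : Interp.{u₁, u₂, u₃, w} NC NR NI)

/-- Truth of an atom over the expanded domain. -/
def Atom.True : Atom NC NR (SkDom O.Dom NR) → Prop
  | .conc A t => proj O t ∈ O.conc A
  | .role r t u => (t, u) ∈ skRole O (.name r)
  | .lt t u => O.lt (proj O t) (proj O u)
  | .ll t u v k => SkLL O (t, u) (v, k)

/-- Truth of a literal over the expanded domain. -/
def Literal.True (L : Literal NC NR (SkDom O.Dom NR)) : Prop :=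
  L.atom.True O ↔ L.sign = true

theorem Literal.compl_true (L : Literal NC NR (SkDom O.Dom NR)) :
    L.compl.True O ↔ ¬ L.True O := by
  obtain ⟨b, a⟩ := L
  cases b <;> simp [Literal.True, Literal.compl]

/-- Interpretations of the Herbrand symbols in the expanded domain. -/
abbrev HInterp : Type (max u₁ u₂ u₃ w) :=
  HSym NC NR NI → List (SkDom O.Dom NR) → SkDom O.Dom NR

/-- The value of a term in the expanded domain. -/
abbrev val {V : Type*} (H : HInterp O) (e : V → SkDom O.Dom NR) (t : Tm NC NR NI V) :
    SkDom O.Dom NR :=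
  t.eval H (fun a => .base (O.ind a)) e

/-- All clauses of the matrix are false under the given valuation. -/
def MatFalse (H : HInterp O) (e : Var → SkDom O.Dom NR) (M : Mat NC NR NI) : Prop :=
  ∀ C ∈ M, ∃ L ∈ C, ¬ (L.map (val O H e)).True O

variable {O} {H : HInterp O} {e : Var → SkDom O.Dom NR}

theorem matFalse_union {M N : Mat NC NR NI} :
    MatFalse O H e (M ∪ N) ↔ MatFalse O H e M ∧ MatFalse O H e N := by
  simp only [MatFalse, Set.mem_union, or_imp, forall_and]

theorem MatFalse.clup_left {M : Mat NC NR NI} (h : MatFalse O H e M) (N : Mat NC NR NI) :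
    MatFalse O H e (clup M N) := by
  rintro _ ⟨C₁, h₁, C₂, -, rfl⟩
  obtain ⟨L, hL, hf⟩ := h C₁ h₁
  exact ⟨L, .inl hL, hf⟩

theorem MatFalse.clup_right {N : Mat NC NR NI} (h : MatFalse O H e N) (M : Mat NC NR NI) :
    MatFalse O H e (clup M N) := by
  rintro _ ⟨C₁, -, C₂, h₂, rfl⟩
  obtain ⟨L, hL, hf⟩ := h C₂ h₂
  exact ⟨L, .inr hL, hf⟩

/-- A clausal union is a conjunction, so one false factor suffices; the case split may depend on the
valuation. -/
theorem matFalse_clup_of_imp {M N : Mat NC NR NI} {p : Prop} (hM : ¬ p → MatFalse O H e M)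
    (hN : p → MatFalse O H e N) : MatFalse O H e (clup M N) := by
  by_cases h : p
  · exact (hN h).clup_right M
  · exact (hM h).clup_left N

theorem matFalse_unit_true {a : Atom NC NR (Tm NC NR NI Var)} :
    MatFalse O H e (unit true a) ↔ ¬ (a.map (val O H e)).True O := by
  simp [MatFalse, unit, Literal.True, Literal.map]

theorem matFalse_unit_false {a : Atom NC NR (Tm NC NR NI Var)} :
    MatFalse O H e (unit false a) ↔ (a.map (val O H e)).True O := by
  simp [MatFalse, unit, Literal.True, Literal.map]

theorem val_apply (f : HSym NC NR NI) (S : List (Tm NC NR NI Var)) :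
    val O H e (apply f S) = H f (S.map (val O H e)) := by
  simp only [val, apply, Term.eval]
  congr 1
  apply List.ext_get <;> simp

end Truth

/-! ### Herbrand functions by positions -/

/-- The statement that labels a Herbrand symbol. -/
def HSym.stmt : HSym NC NR NI → Stmt NC NR NI
  | .conc o _ => o
  | .fst o _ => o
  | .snd o _ => o

/-- The position that labels a Herbrand symbol. -/
def HSym.pos : HSym NC NR NI → List ℕ
  | .conc _ p => p
  | .fst _ p => p
  | .snd _ p => p

section Forced

variable {O : Interp.{u₁, u₂, u₃, w} NC NR NI}

/-- `Q` can be achieved by choosing the Herbrand functions of the statement `o` at the positions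
that extend `p`. -/
def Forceable (o : Stmt NC NR NI) (p : List ℕ) (Q : HInterp O → Prop) : Prop :=
  ∃ H : HInterp O, ∀ H' : HInterp O, (∀ s, s.stmt = o → p <:+ s.pos → H' s = H s) → Q H'

theorem Forceable.mono {o : Stmt NC NR NI} {p : List ℕ} {Q Q' : HInterp O → Prop}
    (h : Forceable o p Q) (hQ : ∀ H, Q H → Q' H) : Forceable o p Q' := by
  obtain ⟨H, hH⟩ := h
  exact ⟨H, fun H' h' => hQ _ (hH H' h')⟩

theorem cons_suffix_unique {i j : ℕ} {p q : List ℕ} (hi : i :: p <:+ q) (hj : j :: p <:+ q) :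
    i = j :=
  (List.cons.inj ((List.suffix_of_suffix_length_le hi hj (by simp)).eq_of_length (by simp))).1

/-- Distinct children `i :: p` are suffixes of disjoint sets of positions, and none is a suffix of
`p`. So the choices for the subtrees can be glued, and the symbols at `p` itself remain free to be
set to `h`. -/
theorem forceable_cons {o : Stmt NC NR NI} {p : List ℕ} {Q : ℕ → HInterp O → Prop}
    (hQ : ∀ i, Forceable o (i :: p) (Q i)) (h : HInterp O) :
    Forceable o p fun H => (∀ i, Q i H) ∧ ∀ s, s.stmt = o → s.pos = p → H s = h s := by
  classical
  choose Hs hHs using hQ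
  refine ⟨fun s => if hs : ∃ i, i :: p <:+ s.pos then Hs hs.choose s else h s, fun H' h' =>
    ⟨fun i => hHs i H' fun s hso hsp => ?_, fun s hso hsp => ?_⟩⟩
  · have hex : ∃ i, i :: p <:+ s.pos := ⟨i, hsp⟩
    rw [h' s hso ((List.suffix_cons i p).trans hsp)]
    beta_reduce
    rw [dif_pos hex, cons_suffix_unique hex.choose_spec hsp]
  · rw [h' s hso (by rw [hsp])]
    refine dif_neg ?_
    rintro ⟨i, hi⟩
    have := hi.length_le
    rw [hsp] at this
    simp at this

theorem forceable_of_forall {o : Stmt NC NR NI} {p : List ℕ} {Q : HInterp O → Prop}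
    (h : ∀ H, Q H) : Forceable o p Q :=
  haveI := O.nonempty
  ⟨fun _ _ => .base (Classical.arbitrary _), fun H' _ => h H'⟩

/-! ### Roles -/

theorem matFalse_rhoNegBulRole {H : HInterp O} {e : Var → SkDom O.Dom NR} {p : List ℕ} {r : NR}
    {t u : Tm NC NR NI Var} (h : (val O H e t, val O H e u) ∈ skRole O (.bul (.name r))) :
    MatFalse O H e (rhoNegBulRole p r t u) := by
  refine matFalse_union.2 ⟨matFalse_unit_false.2 (skRole_bul_subset O r h), ?_⟩
  by_cases hr : (e (0, p), e (1, p)) ∈ skRole O (.name r)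
  · refine MatFalse.clup_left (matFalse_unit_true.2 ?_) _
    exact not_skLL_of_mem_bul O h hr
  · refine MatFalse.clup_right (matFalse_unit_true.2 ?_) _
    exact hr

/-- Negated roles introduce variables but no Herbrand symbols, so this holds for every `H`. -/
theorem matFalse_rhoRole_false {H : HInterp O} {e : Var → SkDom O.Dom NR} {o : Stmt NC NR NI}
    {p : List ℕ} {R : Role NR} {t u : Tm NC NR NI Var}
    (h : (val O H e t, val O H e u) ∈ skRole O R) : MatFalse O H e (rhoRole o false R p t u) := by
  rw [skRole_eq] at h
  unfold rhoRole
  cases hR : R.isBul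
  · rw [hR] at h
    exact matFalse_unit_false.2 h
  · rw [hR] at h
    exact matFalse_rhoNegBulRole h

theorem forceable_rhoRole_true (o : Stmt NC NR NI) (R : Role NR) (p : List ℕ) :
    Forceable (O := O) o p fun H => ∀ e t u, (val O H e t, val O H e u) ∉ skRole O R →
      MatFalse O H e (rhoRole o true R p t u) := by
  have hd := O.nonempty
  -- The symbols f, g of •r are interpreted by the free constructors, each of which needs only its
  -- own component.
  let h : HInterp O := fun s l => match s, l with
    | .fst _ _, [t] => .fst R.base t
    | .snd _ _, [t] => .snd R.base t
    | _, _ => .base (Classical.arbitrary _)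
  refine ⟨h, fun H' hH' e t u hR => ?_⟩
  have hf : H' (.fst o p) = h (.fst o p) := hH' _ rfl (List.suffix_refl p)
  have hs : H' (.snd o p) = h (.snd o p) := hH' _ rfl (List.suffix_refl p)
  rw [skRole_eq] at hR
  unfold rhoRole
  cases hb : R.isBul
  · rw [hb] at hR
    exact matFalse_unit_true.2 hR
  · rw [hb] at hR
    have hvf : val O H' e (apply (.fst o p) [t]) = .fst R.base (val O H' e t) := by
      rw [val_apply, hf]; rfl
    have hvs : val O H' e (apply (.snd o p) [u]) = .snd R.base (val O H' e u) := by
      rw [val_apply, hs]; rfl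
    refine matFalse_clup_of_imp (p := (val O H' e t, val O H' e u) ∈ skRole O (.name R.base))
      (fun hn => matFalse_unit_true.2 hn) fun hn => matFalse_union.2 ⟨matFalse_unit_false.2 ?_,
        matFalse_rhoNegBulRole ?_⟩
    · simp only [Atom.map, Atom.True, hvf, hvs]
      exact skLL_fst_snd O _ _ _
    · rw [hvf, hvs]
      exact mem_skRole_bul_of_not_mem O hn hR

/-! ### Concepts -/

/-- The extension of `D` (for `b = true`) or of `¬D` (for `b = false`). -/
def Interp.sext (O : Interp.{u₁, u₂, u₃, w} NC NR NI) (D : Concept NC NR) (b : Bool) :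
    Set O.Dom :=
  {d | d ∈ O.ext D ↔ b = true}

/-- The translation of `D` or `¬D` is false at the elements outside its extension, if the value of
the term is the function `τ` of the values of the string in scope. -/
def RhoFalse (o : Stmt NC NR NI) (D : Concept NC NR) (b : Bool) (p : List ℕ)
    (τ : List (SkDom O.Dom NR) → SkDom O.Dom NR) (H : HInterp O) : Prop :=
  ∀ e t S, val O H e t = τ (S.map (val O H e)) → proj O (val O H e t) ∉ O.sext D b →
    MatFalse O H e (rho o D b p t S)

/-- The last element of a string of values. -/
noncomputable def lastVal (O : Interp.{u₁, u₂, u₃, w} NC NR NI) (l : List (SkDom O.Dom NR)) :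
    SkDom O.Dom NR :=
  haveI := O.nonempty
  l.getLastD (.base (Classical.arbitrary _))

theorem lastVal_append (l : List (SkDom O.Dom NR)) (t : SkDom O.Dom NR) :
    lastVal O (l ++ [t]) = t := by
  simp [lastVal]

theorem RhoFalse.var {o : Stmt NC NR NI} {D : Concept NC NR} {b : Bool} {p : List ℕ}
    {H : HInterp O} (h : RhoFalse o D b p (lastVal O) H) {e : Var → SkDom O.Dom NR}
    (S : List (Tm NC NR NI Var)) (x : Var) (hx : proj O (e x) ∉ O.sext D b) :
    MatFalse O H e (rho o D b p (.var x) (S ++ [.var x])) :=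
  h e (.var x) _ (by rw [List.map_append]; exact (lastVal_append _ _).symm) hx

/-- Induction on the concept for all `b`, `p`, `τ`. A witness depends on the value of the term, but
its symbol is applied only to the string `S`; `τ` recovers the value of the term from that string.
It is `lastVal` below a new variable, and the chosen Herbrand function below a Herbrand term. -/
theorem forceable_rho (o : Stmt NC NR NI) (D : Concept NC NR) : ∀ (b : Bool) (p : List ℕ)
    (τ : List (SkDom O.Dom NR) → SkDom O.Dom NR), Forceable o p (RhoFalse o D b p τ) := by
  have hd := O.nonempty
  -- the existential quantifier, with a negated and an unnegated body
  have quant : ∀ (R : Role NR) (D : Concept NC NR),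
      (∀ (b : Bool) (p : List ℕ) τ, Forceable o p (RhoFalse (O := O) o D b p τ)) →
      ∀ (b : Bool) (p : List ℕ), Forceable (O := O) o p fun H => ∀ e t S,
        (∀ y, (proj O (val O H e t), y) ∈ O.roleExt R → y ∉ O.sext D b) →
        MatFalse O H e (clup (rhoRole o true R (0 :: p) t (.var (0, p)))
          (rho o D b (1 :: p) (.var (0, p)) (S ++ [.var (0, p)]))) := by
    intro R D ih b p
    refine (forceable_cons (Q := fun i H => match i with
      | 0 => ∀ e t u, (val O H e t, val O H e u) ∉ skRole O R →
          MatFalse O H e (rhoRole o true R (0 :: p) t u)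
      | 1 => RhoFalse o D b (1 :: p) (lastVal O) H
      | _ => _root_.True) ?_ (fun _ _ => .base (Classical.arbitrary _))).mono ?_
    · rintro (_ | _ | _)
      · exact forceable_rhoRole_true o R _
      · exact ih _ _ _
      · exact forceable_of_forall fun _ => trivial
    · rintro H ⟨hQ, -⟩ e t S hy
      refine matFalse_clup_of_imp (hQ 0 e t (.var (0, p))) fun hR => ?_
      exact (hQ 1).var S (0, p) (hy _ (proj_mem_roleExt O hR))
  -- the universal quantifier
  have univ : ∀ (R : Role NR) (D : Concept NC NR),
      (∀ (b : Bool) (p : List ℕ) τ, Forceable o p (RhoFalse (O := O) o D b p τ)) →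
      ∀ (b : Bool) (p : List ℕ) (τ : List (SkDom O.Dom NR) → SkDom O.Dom NR),
        Forceable (O := O) o p fun H => ∀ e t S, val O H e t = τ (S.map (val O H e)) →
        (∃ y, (proj O (val O H e t), y) ∈ O.roleExt R ∧ y ∉ O.sext D b) →
        MatFalse O H e (rhoRole o false R (0 :: p) t (apply (.conc o p) S) ∪
          rho o D b (1 :: p) (apply (.conc o p) S) S) := by
    intro R D ih b p τ
    -- A successor violating the body, chosen from the string alone through `τ`.
    let h : List (SkDom O.Dom NR) → SkDom O.Dom NR := fun l =>
      .base (Classical.epsilon fun y => (proj O (τ l), y) ∈ O.roleExt R ∧ y ∉ O.sext D b)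
    refine (forceable_cons (fun i => ih b (i :: p) h) (fun _ => h)).mono ?_
    rintro H ⟨hQ, hr⟩ e t S ht hy
    have hc : val O H e (apply (.conc o p) S) = h (S.map (val O H e)) := by
      rw [val_apply, hr _ rfl rfl]
    rw [ht] at hy
    have hs := Classical.epsilon_spec hy
    refine matFalse_union.2 ⟨matFalse_rhoRole_false ?_, hQ 1 e _ S hc ?_⟩
    · rw [hc, ht]
      exact (mem_skRole_base O).2 hs.1
    · rw [hc]
      exact hs.2
  -- conjunction and disjunction
  have pair : ∀ (D E : Concept NC NR),
      (∀ (b : Bool) (p : List ℕ) τ, Forceable o p (RhoFalse (O := O) o D b p τ)) →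
      (∀ (b : Bool) (p : List ℕ) τ, Forceable o p (RhoFalse (O := O) o E b p τ)) →
      ∀ (b : Bool) (p : List ℕ) τ, Forceable o p fun H => RhoFalse (O := O) o D b (0 :: p) τ H ∧
        RhoFalse (O := O) o E b (1 :: p) τ H := by
    intro D E ihD ihE b p τ
    refine (forceable_cons (Q := fun i H => match i with
      | 0 => RhoFalse o D b (0 :: p) τ H
      | 1 => RhoFalse o E b (1 :: p) τ H
      | _ => _root_.True) ?_ (fun _ _ => .base (Classical.arbitrary _))).mono ?_
    · rintro (_ | _ | _)
      · exact ihD _ _ _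
      · exact ihE _ _ _
      · exact forceable_of_forall fun _ => trivial
    · exact fun H hQ => ⟨hQ.1 0, hQ.1 1⟩
  induction D with
  | name A =>
    intro b p τ
    refine forceable_of_forall fun H e t S _ hA => ?_
    cases b
    · have hA : proj O (val O H e t) ∈ O.conc A := by simpa [Interp.sext, Interp.ext] using hA
      exact matFalse_unit_false.2 hA
    · have hA : proj O (val O H e t) ∉ O.conc A := by simpa [Interp.sext, Interp.ext] using hA
      exact matFalse_unit_true.2 hA
  | top =>
    intro b p τ
    refine forceable_of_forall fun H e t S _ hA => ?_
    cases b
    · exact fun C hC => hC.elim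
    · simp [Interp.sext, Interp.ext] at hA
  | bot =>
    intro b p τ
    refine forceable_of_forall fun H e t S _ hA => ?_
    cases b
    · simp [Interp.sext, Interp.ext] at hA
    · exact fun C hC => hC.elim
  | neg D ih =>
    intro b p τ
    refine (forceable_cons (fun i => ih (!b) (i :: p) τ)
      (fun _ _ => .base (Classical.arbitrary _))).mono ?_
    rintro H ⟨hQ, -⟩ e t S ht hA
    rw [rho]
    refine hQ 0 e t S ht ?_
    cases b <;> simpa [Interp.sext, Interp.ext] using hA
  | and D E ihD ihE =>
    intro b p τ
    refine (pair D E ihD ihE b p τ).mono ?_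
    rintro H ⟨hD, hE⟩ e t S ht hA
    cases b
    · have hA : proj O (val O H e t) ∈ O.ext D ∧ proj O (val O H e t) ∈ O.ext E := by
        simpa [Interp.sext, Interp.ext] using hA
      exact matFalse_union.2 ⟨hD e t S ht (by simpa [Interp.sext] using hA.1),
        hE e t S ht (by simpa [Interp.sext] using hA.2)⟩
    · have hA : proj O (val O H e t) ∈ O.ext D → proj O (val O H e t) ∉ O.ext E := by
        simpa [Interp.sext, Interp.ext] using hA
      exact matFalse_clup_of_imp (fun h => hD e t S ht (by simpa [Interp.sext] using h))
        fun h => hE e t S ht (by simpa [Interp.sext] using hA h)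
  | or D E ihD ihE =>
    intro b p τ
    refine (pair D E ihD ihE b p τ).mono ?_
    rintro H ⟨hD, hE⟩ e t S ht hA
    cases b
    · have hA : proj O (val O H e t) ∉ O.ext D → proj O (val O H e t) ∈ O.ext E := by
        simpa [Interp.sext, Interp.ext, or_iff_not_imp_left] using hA
      exact matFalse_clup_of_imp (p := proj O (val O H e t) ∉ O.ext D)
        (fun h => hD e t S ht (by simpa [Interp.sext] using h))
        fun h => hE e t S ht (by simpa [Interp.sext] using hA h)
    · have hA : proj O (val O H e t) ∉ O.ext D ∧ proj O (val O H e t) ∉ O.ext E := by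
        simpa [Interp.sext, Interp.ext] using hA
      exact matFalse_union.2 ⟨hD e t S ht (by simpa [Interp.sext] using hA.1),
        hE e t S ht (by simpa [Interp.sext] using hA.2)⟩
  | all R D ih =>
    intro b p τ
    cases b
    · refine (quant R D ih false p).mono fun H hH e t S _ hA => ?_
      rw [rho]
      exact hH e t S (by simpa [Interp.sext, Interp.ext] using hA)
    · refine (univ R D ih true p τ).mono fun H hH e t S ht hA => ?_
      rw [rho]
      exact hH e t S ht (by simpa [Interp.sext, Interp.ext] using hA)
  | ex R D ih =>
    intro b p τ
    cases b
    · refine (univ R D ih false p τ).mono fun H hH e t S ht hA => ?_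
      rw [rho]
      exact hH e t S ht (by simpa [Interp.sext, Interp.ext] using hA)
    · refine (quant R D ih true p).mono fun H hH e t S _ hA => ?_
      rw [rho]
      exact hH e t S (by simpa [Interp.sext, Interp.ext] using hA)
  | bul D ih =>
    -- the translation of `¬•D`
    have neg_bul : ∀ (p : List ℕ) (τ : List (SkDom O.Dom NR) → SkDom O.Dom NR) (H : HInterp O),
        RhoFalse o D false (1 :: p) τ H → RhoFalse o D true (2 :: p) (lastVal O) H →
        ∀ e t S, val O H e t = τ (S.map (val O H e)) →
          proj O (val O H e t) ∈ minSet O.lt (O.ext D) →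
          MatFalse O H e (rho o D false (1 :: p) t S ∪ clup (unit true (.lt (.var (0, p)) t))
            (rho o D true (2 :: p) (.var (0, p)) (S ++ [.var (0, p)]))) := by
      intro p τ H h1 h2 e t S ht hm
      refine matFalse_union.2 ⟨h1 e t S ht (by simpa [Interp.sext] using hm.1), ?_⟩
      refine matFalse_clup_of_imp (p := O.lt (proj O (e (0, p))) (proj O (val O H e t)))
        (fun h => matFalse_unit_true.2 h) fun h => h2.var S (0, p) fun hD => ?_
      exact hm.2 _ (by simpa [Interp.sext] using hD) h
    intro b p τ
    cases b
    · refine (forceable_cons (Q := fun i H => match i with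
        | 1 => RhoFalse o D false (1 :: p) τ H
        | 2 => RhoFalse o D true (2 :: p) (lastVal O) H
        | _ => _root_.True) ?_ (fun _ _ => .base (Classical.arbitrary _))).mono ?_
      · rintro (_ | _ | _ | _)
        · exact forceable_of_forall fun _ => trivial
        · exact ih _ _ _
        · exact ih _ _ _
        · exact forceable_of_forall fun _ => trivial
      · rintro H ⟨hQ, -⟩ e t S ht hA
        rw [rho]
        exact neg_bul p τ H (hQ 1) (hQ 2) e t S ht (by simpa [Interp.sext, Interp.ext] using hA)
    · let h : List (SkDom O.Dom NR) → SkDom O.Dom NR := fun l => .base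
        (Classical.epsilon fun y => y ∈ minSet O.lt (O.ext D) ∧ O.lt y (proj O (τ l)))
      refine (forceable_cons (Q := fun i H => match i with
        | 0 => RhoFalse o D true (0 :: p) τ H
        | 1 => RhoFalse o D false (1 :: p) h H
        | 2 => RhoFalse o D true (2 :: p) (lastVal O) H
        | _ => _root_.True) ?_ (fun _ => h)).mono ?_
      · rintro (_ | _ | _ | _)
        · exact ih _ _ _
        · exact ih _ _ _
        · exact ih _ _ _
        · exact forceable_of_forall fun _ => trivial
      · rintro H ⟨hQ, hr⟩ e t S ht hA
        rw [rho]
        have hc : val O H e (apply (.conc o p) S) = h (S.map (val O H e)) := by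
          rw [val_apply, hr _ rfl rfl]
        refine matFalse_clup_of_imp (p := proj O (val O H e t) ∈ O.ext D)
          (fun hD => hQ 0 e t S ht (by simpa [Interp.sext] using hD)) fun hD => ?_
        have hex := exists_minSet_lt O.lt_wf O.lt_trans hD
          (by simpa [Interp.sext, Interp.ext] using hA)
        rw [ht] at hex
        have hs := Classical.epsilon_spec hex
        refine matFalse_union.2 ⟨matFalse_unit_false.2 ?_, neg_bul p h H (hQ 1) (hQ 2) e _ S hc ?_⟩
        · simp only [Atom.map, Atom.True, hc, ht]
          exact hs.2
        · rw [hc]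
          exact hs.1

/-! ### The matrix of a knowledge base -/

theorem forceable_pair {o : Stmt NC NR NI} {Q₀ Q₁ : HInterp O → Prop} (h₀ : Forceable o [0] Q₀)
    (h₁ : Forceable o [1] Q₁) : ∃ H : HInterp O, ∀ H' : HInterp O,
      (∀ s, s.stmt = o → H' s = H s) → Q₀ H' ∧ Q₁ H' := by
  have hd := O.nonempty
  obtain ⟨H, hH⟩ := forceable_cons (Q := fun i H => match i with
    | 0 => Q₀ H
    | 1 => Q₁ H
    | _ => _root_.True) (o := o) (p := []) (by
      rintro (_ | _ | _)
      · exact h₀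
      · exact h₁
      · exact forceable_of_forall fun _ => trivial) (fun _ _ => .base (Classical.arbitrary _))
  exact ⟨H, fun H' h' => ⟨(hH H' fun s hs _ => h' s hs).1 0, (hH H' fun s hs _ => h' s hs).1 1⟩⟩

/-- The matrix of a statement. -/
def deltaStmt : Stmt NC NR NI → Mat NC NR NI
  | .gci D E => deltaGCI D E
  | .rincl R S => deltaRIncl R S
  | .assertion α => deltaAssertion α

/-- Satisfaction of a statement. -/
def Interp.SatStmt (O : Interp.{u₁, u₂, u₃, w} NC NR NI) : Stmt NC NR NI → Prop
  | .gci D E => O.ext D ⊆ O.ext E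
  | .rincl R S => O.roleExt R ⊆ O.roleExt S
  | .assertion α => O.SatAssertion α

theorem exists_matFalse_deltaStmt (o : Stmt NC NR NI) : ∃ H : HInterp O, ∀ H' : HInterp O,
    (∀ s, s.stmt = o → H' s = H s) → O.SatStmt o → ∀ e, MatFalse O H' e (deltaStmt o) := by
  have tail : ∀ {i : ℕ} {Q : HInterp O → Prop}, Forceable o [i] Q → ∃ H : HInterp O,
      ∀ H' : HInterp O, (∀ s, s.stmt = o → H' s = H s) → Q H' :=
    fun ⟨H, hH⟩ => ⟨H, fun H' h' => hH H' fun s hs _ => h' s hs⟩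
  match o with
  | .gci D E =>
    -- Both sides share the root variable, whose string is that variable alone; hence `lastVal`.
    obtain ⟨H, hH⟩ := forceable_pair (forceable_rho (O := O) (.gci D E) D true [0] (lastVal O))
      (forceable_rho (.gci D E) E false [1] (lastVal O))
    refine ⟨H, fun H' h' hs e => ?_⟩
    obtain ⟨hD, hE⟩ := hH H' h'
    refine matFalse_clup_of_imp (p := proj O (e (0, [])) ∈ O.ext D)
      (fun h => hD.var [] (0, []) ?_) fun h => hE.var [] (0, []) ?_
    · simpa [Interp.sext] using h
    · simpa [Interp.sext] using hs h
  | .rincl R S =>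
    obtain ⟨H, hH⟩ := tail (forceable_rhoRole_true (O := O) (.rincl R S) R [0])
    refine ⟨H, fun H' h' hs e => ?_⟩
    exact matFalse_clup_of_imp (hH H' h' e (rootVar 0) (rootVar 1)) fun h =>
      matFalse_rhoRole_false ⟨h.1, h.2.trans hs⟩
  | .assertion (.conc a D) =>
    obtain ⟨H, hH⟩ := tail (forceable_rho (O := O) (.assertion (.conc a D)) D false [0]
      fun _ => .base (O.ind a))
    refine ⟨H, fun H' h' hs e => hH H' h' e (.ind a) [] rfl ?_⟩
    have hs : O.ind a ∈ O.ext D := hs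
    simpa [Interp.sext, val, Term.eval, proj] using hs
  | .assertion (.role a b R) =>
    obtain ⟨H, -⟩ := forceable_of_forall (O := O) (o := o) (p := []) (Q := fun _ => _root_.True)
      fun _ => trivial
    exact ⟨H, fun H' _ hs e => matFalse_rhoRole_false ((mem_skRole_base O).2 hs)⟩
  | .assertion (.negRole a b R) =>
    obtain ⟨H, hH⟩ := tail (forceable_rhoRole_true (O := O) (.assertion (.negRole a b R)) R [0])
    exact ⟨H, fun H' h' hs e => hH H' h' e (.ind a) (.ind b) fun h => hs ((mem_skRole_base O).1 h)⟩

theorem matFalse_orderMat (H : HInterp O) (e : Var → SkDom O.Dom NR) :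
    MatFalse O H e orderMat := by
  intro C hC
  by_contra hn
  push Not at hn
  simp only [orderMat, Set.mem_insert_iff, Set.mem_singleton_iff] at hC
  rcases hC with rfl | rfl | rfl | rfl | rfl | rfl <;>
    simp [Literal.True, Literal.map, Atom.map, Atom.True] at hn
  · exact hn.2.2 (O.lt_trans _ _ _ hn.1 hn.2.1)
  · exact O.lt_irrefl _ hn
  · exact O.lt_irrefl _ (O.lt_trans _ _ _ hn.1 hn.2)
  · exact hn.2.2 (skLL_trans O hn.1 hn.2.1)
  · exact skLL_irrefl O _ hn
  · exact skLL_irrefl O _ (skLL_trans O hn.1 hn.2)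

/-- Each symbol is interpreted by the choice made for its own statement, so the choices for
different statements never conflict. -/
theorem exists_matFalse_delta {K : KB NC NR NI} (hO : O.Sat K) :
    ∃ H : HInterp O, ∀ e, MatFalse O H e (delta K) := by
  choose Hs hHs using fun o : Stmt NC NR NI => exists_matFalse_deltaStmt (O := O) o
  have key := fun o => hHs o (fun s => Hs s.stmt s) fun s hs => by rw [hs]
  obtain ⟨hT, hR, hA⟩ := hO
  refine ⟨fun s => Hs s.stmt s, fun e C hC => ?_⟩
  simp only [delta, Set.mem_union, Set.mem_iUnion] at hC
  rcases hC with ((⟨c, hc, hC⟩ | ⟨c, hc, hC⟩) | ⟨α, hα, hC⟩) | hC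
  · exact key (.gci c.1 c.2) (hT c hc) e C hC
  · exact key (.rincl c.1 c.2) (hR c hc) e C hC
  · exact key (.assertion α) (hA α hα) e C hC
  · exact matFalse_orderMat _ e C hC

end Forced

/-! ### Soundness of the calculus -/

section Soundness

variable {O : Interp.{u₁, u₂, u₃, w} NC NR NI} {H : HInterp O} {M : Mat NC NR NI}
  {μ : Clause NC NR NI → ℕ} {σ : Subst NC NR NI} {e : CopyVar NC NR NI → SkDom O.Dom NR}

/-- A copy under `σ` is evaluated like the original clause at the valuation sending x to the value
of `σ (C, i, x)`. -/
theorem exists_false_of_copyClause (hM : ∀ e, MatFalse O H e M) {C : Clause NC NR NI} (hC : C ∈ M)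
    (i : ℕ) : ∃ L ∈ copyClause C i, ¬ ((inst σ L).map (val O H e)).True O := by
  obtain ⟨L, hL, hf⟩ := hM (fun x => val O H e (σ (C, i, x))) C hC
  refine ⟨_, ⟨L, hL, rfl⟩, ?_⟩
  have : val O H e ∘ Term.subst σ ∘ copyTerm C i = val O H fun x => val O H e (σ (C, i, x)) := by
    funext t
    simp only [Function.comp, val, copyTerm, Term.eval_subst]
    rfl
  rwa [inst, Literal.map_map, Literal.map_map, Function.comp_assoc, this]

/-- If all literals of the path are false, then all literals of a goal with a proof are true. -/
theorem ProofTrue.sound (hM : ∀ e, MatFalse O H e M) {G P : Set (CLit NC NR NI)}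
    (h : ProofTrue M μ σ G P) (hP : ∀ L ∈ P, ¬ ((inst σ L).map (val O H e)).True O) :
    ∀ L ∈ G, ((inst σ L).map (val O H e)).True O := by
  have compl : ∀ L₁ L₂ : CLit NC NR NI, inst σ L₁ = inst σ L₂.compl →
      (((inst σ L₁).map (val O H e)).True O ↔ ¬ ((inst σ L₂).map (val O H e)).True O) := by
    intro L₁ L₂ h
    rw [h, ← Literal.compl_true]
    rfl
  induction h with
  | empty P => simp
  | rule G P ts hr _ ih =>
    cases hr with
    | reduction C _ L₁ L₂ _ hL₂ hL =>
      rintro L (rfl | hLC)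
      · exact (compl _ _ hL).2 (hP _ hL₂)
      · exact ih (C, P) (by simp) hP L hLC
    | extension C _ L₁ L₂ C₂ i _ hC₂ _ _ _ _ hL =>
      rintro L (rfl | hLC)
      -- With `L` false, the extended path is still false, so the rest of the copy is true. The
      -- false literal of the copy must then be `L₂`, whose complement is `L`.
      · by_contra hf
        obtain ⟨L', hL', hf'⟩ := exists_false_of_copyClause (σ := σ) (e := e) hM hC₂ i
        by_cases heq : L' = L₂
        · subst heq
          exact hf ((compl _ _ hL).2 hf')
        · refine hf' (ih (copyClause C₂ i \ {L₂}, insert L P) (by simp) ?_ L' ⟨hL', heq⟩)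
          rintro L'' (rfl | h'')
          · exact hf
          · exact hP _ h''
      · exact ih (C, P) (by simp) hP L hLC

end Soundness

end ALCHB

theorem mainTheorem1 {NC : Type u₁} {NR : Type u₂} {NI : Type u₃} (K : ALCHB.KB NC NR NI)
    (hK : ALCHB.InconsistentReturnsTrue K) : ALCHB.KB.Inconsistent.{u₁, u₂, u₃, w} K := by
  intro O hO
  obtain ⟨H, hH⟩ := ALCHB.exists_matFalse_delta hO
  obtain ⟨μ, σ, -, C, hC, i, -, -, -, hp⟩ := hK
  -- Any valuation of the variables will do; a constant one is used.
  obtain ⟨d⟩ := O.nonempty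
  obtain ⟨L, hL, hf⟩ := ALCHB.exists_false_of_copyClause (σ := σ) (e := fun _ => .base d) hH hC i
  exact hf (hp.sound hH (by simp) L hL)
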